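/- Let $G=(S,T;E)$ be a finite simple bipartite graph with colour classes $S$ and $T$ in which every node of $S$ has degree at most $4$ and every node of $T$ has degree at most $3$. An $S$-link is a path $P=(\{u,v,w\},\{uv,vw\})$ of length $2$ in $G$ whose two (distinct) end-nodes $u,w$ belong to $S$. Then $G$ has a matching $M\subseteq E$ and a family $\mathcal{F}$ of pairwise node-disjoint $S$-links such that every node $v\in T$ of degree $3$ is incident to an edge of $M\cup\bigcup_{P\in\mathcal{F}}E(P)$, where $E(P)$ is the edge set of $P$. (The matching $M$ and the links in $\mathcal{F}$ may share nodes.) -/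

import Mathlib

/-- For a bipartite graph `G` with colour class `S`, an `S`-link is a path
`P = ({u, v, w}, {uv, vw})` of length two in `G` with both end-nodes `u`, `w` in `S`. -/
def SimpleGraph.Subgraph.IsLink {V : Type*} {G : SimpleGraph V} (S : Set V)
    (P : G.Subgraph) : Prop :=
  ∃ u v w : V, u ∈ S ∧ w ∈ S ∧ u ≠ w ∧
    P.verts = {u, v, w} ∧ P.edgeSet = {s(u, v), s(v, w)}

/-! Let `N s` be the set of degree-3 nodes of `T` adjacent to `s`; it has at most four points, and
each point lies in exactly three of these sets. A trimming `H` is read as a graph on the points, its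
two-point members being edges, none of them isolated.

A trimming that covers every point suffices. Each nonempty member represents one of its points, a
point of degree one if it has one; this gives the matching. A point nobody represents has degree at
least two, so it is the centre of a link, and these links are disjoint because members have at most
two points (`IsTrimming.exists_representatives`).

Take a trimming `H₀` with maximal cover number, then maximal total size, and suppose it misses `z`.
Exchanges that do not lower the cover number swap an uncovered point for a leaf or break the middle
edge of a three-edge path; `exposed` collects the points they can uncover. If an exposed point lies
in `N s`, then `H₀ s` has an exposed leaf or is a middle edge with both ends exposed, since
otherwise the cover could grow (`exposed_neighbour`).

Now count unused incidences, `t ∈ N s` but `t ∉ H₀ s`, at exposed `t`, leaving out members that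
consist of one leaf. A relevant `s` has at most 4 - 2 = 2 of them, paid for by 3 - 1 at its exposed
leaf or by twice 3 - 2 at the ends of its middle edge. A covered point of degree `d` has exactly 3 -
`d` unused incidences and pays at most once, while `z`, or the leaf of a one-leaf member next to
`z`, pays nothing: a contradiction (`familyDegree_pos_of_maximal`). -/

open Finset in
/-- The number of members of the family `H` that contain `t`. -/
def familyDegree {α β : Type*} [Fintype α] [DecidableEq β] (H : α → Finset β) (t : β) : ℕ :=
  #{s | t ∈ H s}

/-! ### Degrees and cover numbers of set families -/

section Families

open Finset

variable {α β : Type*} [Fintype α] [DecidableEq β] {H H' : α → Finset β} {t : β}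

theorem familyDegree_eq_zero : familyDegree H t = 0 ↔ ∀ s, t ∉ H s := by
  simp [familyDegree, Finset.filter_eq_empty_iff]

theorem familyDegree_pos {s : α} (h : t ∈ H s) : 0 < familyDegree H t :=
  Finset.card_pos.2 ⟨s, by simpa using h⟩

theorem exists_mem_of_familyDegree_pos (h : 0 < familyDegree H t) : ∃ s, t ∈ H s := by
  obtain ⟨s, hs⟩ := Finset.card_pos.1 h
  exact ⟨s, by simpa using hs⟩

theorem familyDegree_le_one : familyDegree H t ≤ 1 ↔ ∀ s s', t ∈ H s → t ∈ H s' → s = s' := by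
  simp only [familyDegree, Finset.card_le_one, Finset.mem_filter, Finset.mem_univ, true_and]
  exact ⟨fun h s s' hs hs' => h s hs s' hs', fun h s hs s' hs' => h s s' hs hs'⟩

theorem two_le_familyDegree :
    2 ≤ familyDegree H t ↔ ∃ s s', s ≠ s' ∧ t ∈ H s ∧ t ∈ H s' := by
  rw [← not_lt, Nat.lt_succ_iff, familyDegree_le_one]
  push Not
  exact ⟨fun ⟨s, s', h1, h2, h3⟩ => ⟨s, s', h3, h1, h2⟩,
    fun ⟨s, s', h3, h1, h2⟩ => ⟨s, s', h1, h2, h3⟩⟩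

theorem familyDegree_mono (h : ∀ s, t ∈ H s → t ∈ H' s) :
    familyDegree H t ≤ familyDegree H' t :=
  Finset.card_le_card fun s hs => by simpa using h s (by simpa using hs)

theorem familyDegree_congr (h : ∀ s, t ∈ H s ↔ t ∈ H' s) :
    familyDegree H t = familyDegree H' t :=
  le_antisymm (familyDegree_mono fun s => (h s).1) (familyDegree_mono fun s => (h s).2)

/-- The number of points that lie in some member of the family. -/
def coverNumber [Fintype β] (H : α → Finset β) : ℕ := #{t | 0 < familyDegree H t}

/-- The gain of `t` makes up for the loss of `x`, the only point that may become uncovered. -/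
theorem coverNumber_le_of_exchange [Fintype β] {x : β} (ht : familyDegree H t = 0)
    (ht' : 0 < familyDegree H' t)
    (h : ∀ y, y ≠ x → 0 < familyDegree H y → 0 < familyDegree H' y) :
    coverNumber H ≤ coverNumber H' := by
  have h1 : insert t (({t | 0 < familyDegree H t} : Finset β).erase x) ⊆
      ({t | 0 < familyDegree H' t} : Finset β) := by
    intro y hy
    simp only [Finset.mem_insert, Finset.mem_erase, Finset.mem_filter, Finset.mem_univ,
      true_and] at hy ⊢
    rcases hy with rfl | ⟨hy, hy'⟩
    · exact ht'
    · exact h y hy hy'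
  have h2 := Finset.card_le_card h1
  rw [Finset.card_insert_of_notMem (by simp [ht])] at h2
  have h3 := Finset.pred_card_le_card_erase
    (s := ({t | 0 < familyDegree H t} : Finset β)) (a := x)
  unfold coverNumber
  lia

theorem coverNumber_lt [Fintype β] (ht : familyDegree H t = 0) (ht' : 0 < familyDegree H' t)
    (h : ∀ y, 0 < familyDegree H y → 0 < familyDegree H' y) :
    coverNumber H < coverNumber H' := by
  refine Finset.card_lt_card ((Finset.ssubset_iff_of_subset fun y hy => ?_).2 ⟨t, ?_, ?_⟩)
  · simpa using h y (by simpa using hy)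
  · simpa using ht'
  · simp [ht]

/-! ### Trimmings and exchanges -/

/-- `H` selects at most two points from each member of `N`, and no selected pair `{x, y}` is
isolated, in the sense that `x` or `y` is selected at least twice. -/
structure IsTrimming (N H : α → Finset β) : Prop where
  subset : ∀ s, H s ⊆ N s
  card_le : ∀ s, #(H s) ≤ 2
  exists_two_le : ∀ s, #(H s) = 2 → ∃ x ∈ H s, 2 ≤ familyDegree H x

/-- The pair selected at `m` is the middle edge of a path with three edges. -/
structure IsMiddle (H : α → Finset β) (m : α) : Prop where
  card_eq : #(H m) = 2
  degree_eq : ∀ x ∈ H m, familyDegree H x = 2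
  leaf : ∀ x ∈ H m, ∀ s, s ≠ m → x ∈ H s → ∃ c, c ≠ x ∧ H s = {x, c} ∧ familyDegree H c = 1

/-- The index `s` shares a selected point with some `m ∈ E`. -/
def Touches (H : α → Finset β) (E : Set α) (s : α) : Prop := ∃ m ∈ E, ∃ x ∈ H m, x ∈ H s

/-- The families obtained from `H₀` by exchanges that keep the number of covered points; `E`
records the middle edges that have been broken. -/
inductive Exchanges [DecidableEq α] (N H₀ : α → Finset β) : (α → Finset β) → Set α → Prop
  | base : Exchanges N H₀ H₀ ∅
  | swap {H : α → Finset β} {E : Set α} {s : α} {t x : β} : Exchanges N H₀ H E →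
      ¬ Touches H₀ E s → familyDegree H t = 0 → t ∈ N s → x ∈ H₀ s → x ∈ H s →
      familyDegree H₀ x = 1 →
      Exchanges N H₀ (Function.update H s (insert t ((H s).erase x))) E
  | enter {H : α → Finset β} {E : Set α} {m s : α} {t a y : β} : Exchanges N H₀ H E →
      ¬ Touches H₀ E m → IsMiddle H₀ m → familyDegree H t = 0 → t ∈ N m → a ∈ H₀ m → s ≠ m →
      a ∈ H₀ s → y ∈ H₀ s → y ∈ H s →
      Exchanges N H₀ (Function.update (Function.update H m (insert t ((H m).erase a))) s
        ((H s).erase y)) (insert m E)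

/-- The points left uncovered by some family obtained from `H₀` by exchanges. -/
def exposed [DecidableEq α] (N H₀ : α → Finset β) : Set β :=
  {t | ∃ H E, Exchanges N H₀ H E ∧ familyDegree H t = 0}

/-- The properties preserved by the exchanges. -/
structure ExchangeInvariant [Fintype β] [DecidableEq α] (N H₀ H : α → Finset β) (E : Set α) :
    Prop where
  trimming : IsTrimming N H
  cover_le : coverNumber H₀ ≤ coverNumber H
  core : ∀ x, 2 ≤ familyDegree H₀ x → (∀ m ∈ E, x ∉ H₀ m) → ∀ s, x ∈ H s ↔ x ∈ H₀ s
  card_eq : ∀ s, ¬ Touches H₀ E s → #(H s) = #(H₀ s)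
  low : ∀ x, familyDegree H₀ x ≤ 1 → familyDegree H x ≤ 1
  lost : ∀ s, ¬ Touches H₀ E s → ∀ x ∈ H₀ s, x ∈ H s ∨ x ∈ exposed N H₀
  block : ∀ m ∈ E, IsMiddle H₀ m ∧
    ∀ s, ∀ x ∈ H₀ m, x ∈ H₀ s → ∀ y ∈ H₀ s, y ∈ exposed N H₀

omit [Fintype α] [DecidableEq β] in
theorem notMem_of_not_touches {E : Set α} {s : α} {x : β} (hs : ¬ Touches H E s) (hx : x ∈ H s) :
    ∀ m ∈ E, x ∉ H m :=
  fun m hm hxm => hs ⟨m, hm, x, hxm, hx⟩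

theorem IsTrimming.two_le_of_ne {N : α → Finset β} (h : IsTrimming N H) {s : α} {x y : β}
    (hx : x ∈ H s) (hy : y ∈ H s) (hxy : y ≠ x) (h1 : familyDegree H x ≤ 1) :
    2 ≤ familyDegree H y := by
  have hsub : ({x, y} : Finset β) ⊆ H s := by
    intro z; simp only [mem_insert, mem_singleton]; rintro (rfl | rfl) <;> assumption
  have hc : #({x, y} : Finset β) = 2 := Finset.card_pair hxy.symm
  have heq : H s = {x, y} :=
    (Finset.eq_of_subset_of_card_le hsub (by rw [hc]; exact h.card_le s)).symm
  obtain ⟨z, hz, hz2⟩ := h.exists_two_le s (by rw [heq, hc])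
  rw [heq, mem_insert, mem_singleton] at hz
  rcases hz with rfl | rfl
  · lia
  · exact hz2

/-! ### Exchanges preserve the invariant -/

section Exchange

variable [Fintype β] [DecidableEq α] {N H₀ : α → Finset β} {E : Set α}

/-- Neither `t` nor `x` has degree two in `H`, so no pair loses its witness against isolation; sizes
do not change, and `x` becomes exposed. -/
theorem ExchangeInvariant.swap {s : α} {x : β}
    (h : ExchangeInvariant N H₀ H E) (hE : Exchanges N H₀ H E) (hs : ¬ Touches H₀ E s)
    (ht : familyDegree H t = 0) (hts : t ∈ N s) (hx₀ : x ∈ H₀ s) (hx : x ∈ H s)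
    (hdx : familyDegree H₀ x = 1) :
    ExchangeInvariant N H₀ (Function.update H s (insert t ((H s).erase x))) E := by
  set K := Function.update H s (insert t ((H s).erase x)) with hK
  have htn := familyDegree_eq_zero.1 ht
  have htx : t ≠ x := fun e => htn s (e ▸ hx)
  have hKs : K s = insert t ((H s).erase x) := by simp [hK]
  have hKo : ∀ s', s' ≠ s → K s' = H s' := fun s' h' => by simp [hK, h']
  have hx1 : familyDegree H x ≤ 1 := h.low x hdx.le
  have hinc : ∀ y, y ≠ t → y ≠ x → ∀ s', y ∈ K s' ↔ y ∈ H s' := by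
    intro y hyt hyx s'
    rcases eq_or_ne s' s with rfl | h'
    · simp [hKs, hyt, hyx]
    · rw [hKo s' h']
  have hdeg : ∀ y, y ≠ t → y ≠ x → familyDegree K y = familyDegree H y :=
    fun y h1 h2 => familyDegree_congr (hinc y h1 h2)
  have hcard : ∀ s', #(K s') = #(H s') := by
    intro s'
    rcases eq_or_ne s' s with rfl | h'
    · rw [hKs, Finset.card_insert_of_notMem, Finset.card_erase_add_one hx]
      simp [htn]
    · rw [hKo s' h']
  have hxK : familyDegree K x = 0 := by
    rw [familyDegree_eq_zero]
    intro s'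
    rcases eq_or_ne s' s with rfl | h'
    · simp [hKs, htx.symm]
    · rw [hKo s' h']
      exact fun hx' => h' (familyDegree_le_one.1 hx1 _ _ hx' hx)
  have hExp : x ∈ exposed N H₀ := ⟨K, E, hE.swap hs ht hts hx₀ hx hdx, hxK⟩
  have hpos : ∀ y, 2 ≤ familyDegree H y → y ≠ t ∧ y ≠ x := by
    intro y hy
    constructor <;> rintro rfl <;> lia
  refine ⟨⟨fun s' => ?_, fun s' => ?_, fun s' hs' => ?_⟩, ?_, ?_, ?_, ?_, ?_, h.block⟩
  · rcases eq_or_ne s' s with rfl | h'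
    · rw [hKs]
      exact Finset.insert_subset hts ((Finset.erase_subset _ _).trans (h.trimming.subset _))
    · rw [hKo s' h']; exact h.trimming.subset _
  · rw [hcard]; exact h.trimming.card_le _
  · rw [hcard] at hs'
    obtain ⟨y, hy, hy2⟩ := h.trimming.exists_two_le s' hs'
    obtain ⟨h1, h2⟩ := hpos y hy2
    exact ⟨y, (hinc y h1 h2 s').2 hy, by rwa [hdeg y h1 h2]⟩
  · refine h.cover_le.trans (coverNumber_le_of_exchange (x := x) ht
      (familyDegree_pos (s := s) (by simp [hKs])) fun y hy hy' => ?_)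
    rwa [hdeg y _ hy]
    rintro rfl; lia
  · intro y hy hyE s'
    rw [← h.core y hy hyE s']
    refine hinc y ?_ ?_ s'
    · rintro rfl
      obtain ⟨s'', hs''⟩ := exists_mem_of_familyDegree_pos (H := H₀) (t := y) (by lia)
      exact htn _ ((h.core y hy hyE s'').2 hs'')
    · rintro rfl; lia
  · intro s' hs'; rw [hcard]; exact h.card_eq s' hs'
  · intro y hy
    rcases eq_or_ne y x with rfl | hyx
    · lia
    rcases eq_or_ne y t with rfl | hyt
    · rw [familyDegree_le_one]
      have : ∀ s', y ∈ K s' → s' = s := fun s' hs' => by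
        by_contra h'; rw [hKo s' h'] at hs'; exact htn _ hs'
      exact fun s1 s2 h1 h2 => (this s1 h1).trans (this s2 h2).symm
    · rw [hdeg y hyt hyx]; exact h.low y hy
  · intro s' hs' y hy
    rcases eq_or_ne y x with rfl | hyx
    · exact Or.inr hExp
    rcases h.lost s' hs' y hy with h' | h'
    · exact Or.inl ((hinc y (by rintro rfl; exact htn _ h') hyx s').2 h')
    · exact Or.inr h'

/-- Only `y` can be lost, and `t` is gained at `m`. The new member at `m` is not isolated because
its other old end keeps degree two, and the member at `s` drops to at most one point, where no
condition applies. -/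
theorem ExchangeInvariant.enter_properties {m s : α} {a y : β}
    (h : ExchangeInvariant N H₀ H E) (hm : ¬ Touches H₀ E m) (hmid : IsMiddle H₀ m)
    (ht : familyDegree H t = 0) (htm : t ∈ N m) (ha : a ∈ H₀ m) (hsm : s ≠ m)
    (has : a ∈ H₀ s) (hys₀ : y ∈ H₀ s) (hys : y ∈ H s)
    (K : α → Finset β) (hK : K = Function.update (Function.update H m (insert t ((H m).erase a))) s
        ((H s).erase y)) :
    familyDegree K y = 0 ∧ IsTrimming N K ∧ coverNumber H₀ ≤ coverNumber K ∧
    (∀ x, 2 ≤ familyDegree H₀ x → (∀ m' ∈ insert m E, x ∉ H₀ m') → ∀ s, x ∈ K s ↔ x ∈ H₀ s) ∧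
    (∀ s', ¬ Touches H₀ (insert m E) s' → K s' = H s') ∧
    (∀ x, familyDegree H₀ x ≤ 1 → familyDegree K x ≤ 1) := by
  have htn := familyDegree_eq_zero.1 ht
  have hKm : K m = insert t ((H m).erase a) := by simp [hK, hsm.symm]
  have hKs : K s = (H s).erase y := by simp [hK]
  have hKo : ∀ s', s' ≠ m → s' ≠ s → K s' = H s' := fun s' h1 h2 => by simp [hK, h1, h2]
  have haE := notMem_of_not_touches hm ha
  have hda := hmid.degree_eq a ha
  have hainc := h.core a hda.ge haE
  have haH : familyDegree H a = 2 := by rw [familyDegree_congr hainc, hda]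
  have ham : a ∈ H m := (hainc m).2 ha
  have hasH : a ∈ H s := (hainc s).2 has
  have hao : ∀ s', a ∈ H s' → s' = m ∨ s' = s := by
    intro s' hs'
    by_contra! hne
    have h3 : #({m, s, s'} : Finset α) ≤ familyDegree H a := by
      refine Finset.card_le_card fun z => ?_
      simp only [mem_insert, mem_singleton, mem_filter, mem_univ, true_and]
      rintro (rfl | rfl | rfl) <;> assumption
    rw [Finset.card_eq_three.2 ⟨m, s, s', hsm.symm, hne.1.symm, hne.2.symm, rfl⟩] at h3
    lia
  have hta : t ≠ a := fun e => htn m (e ▸ ham)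
  have hty : t ≠ y := fun e => htn s (e ▸ hys)
  -- Either `y` is the leaf `c`, and `a` stays covered at `s`, or `y = a`, which is then lost from
  -- both of its members.
  obtain ⟨c, hca, hsc, hdc⟩ := hmid.leaf a ha s hsm has
  have hyac : y = a ∨ y = c := by simpa [hsc] using hys₀
  have hylow : y ≠ a → familyDegree H₀ y = 1 ∧ familyDegree H y ≤ 1 := by
    intro hya
    have : familyDegree H₀ y = 1 := by rw [hyac.resolve_left hya, hdc]
    exact ⟨this, h.low y this.le⟩
  have hinc : ∀ x, x ≠ t → x ≠ a → x ≠ y → ∀ s', x ∈ K s' ↔ x ∈ H s' := by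
    intro x hxt hxa hxy s'
    rcases eq_or_ne s' m with rfl | h'
    · simp [hKm, hxt, hxa]
    rcases eq_or_ne s' s with rfl | h''
    · simp [hKs, hxy]
    · rw [hKo s' h' h'']
  have hdeg : ∀ x, x ≠ t → x ≠ a → x ≠ y → familyDegree K x = familyDegree H x :=
    fun x h1 h2 h3 => familyDegree_congr (hinc x h1 h2 h3)
  have hyK : familyDegree K y = 0 := by
    rw [familyDegree_eq_zero]
    intro s'
    rcases eq_or_ne s' s with rfl | h''
    · simp [hKs]
    rcases eq_or_ne y a with rfl | hya
    · rcases eq_or_ne s' m with rfl | h'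
      · simp [hKm, hta.symm]
      · rw [hKo s' h' h'']; exact fun h3 => (hao s' h3).elim h' h''
    · have hys' : y ∉ H s' := fun h3 => h'' (familyDegree_le_one.1 (hylow hya).2 _ _ h3 hys)
      rcases eq_or_ne s' m with rfl | h'
      · simp [hKm, hty.symm, hys']
      · rwa [hKo s' h' h'']
  have htK : familyDegree K t ≤ 1 := by
    rw [familyDegree_le_one]
    have : ∀ s', t ∈ K s' → s' = m := fun s' hs' => by
      by_contra h'
      rcases eq_or_ne s' s with rfl | h''
      · rw [hKs] at hs'; exact htn _ (Finset.mem_of_mem_erase hs')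
      · rw [hKo s' h' h''] at hs'; exact htn _ hs'
    exact fun s1 s2 h1 h2 => (this s1 h1).trans (this s2 h2).symm
  have hcm : #(H m) = 2 := by rw [h.card_eq m hm, hmid.card_eq]
  refine ⟨hyK, ⟨fun s' => ?_, fun s' => ?_, fun s' hs' => ?_⟩, ?_, ?_, ?_, ?_⟩
  · rcases eq_or_ne s' m with rfl | h'
    · rw [hKm]
      exact Finset.insert_subset htm ((Finset.erase_subset _ _).trans (h.trimming.subset _))
    rcases eq_or_ne s' s with rfl | h''
    · rw [hKs]; exact (Finset.erase_subset _ _).trans (h.trimming.subset _)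
    · rw [hKo s' h' h'']; exact h.trimming.subset _
  · rcases eq_or_ne s' m with rfl | h'
    · rw [hKm]
      exact (Finset.card_insert_le _ _).trans (by rw [Finset.card_erase_of_mem ham, hcm])
    rcases eq_or_ne s' s with rfl | h''
    · rw [hKs]; exact Finset.card_erase_le.trans (h.trimming.card_le _)
    · rw [hKo s' h' h'']; exact h.trimming.card_le _
  · rcases eq_or_ne s' m with rfl | h'
    · obtain ⟨b, hb, hba⟩ := Finset.exists_mem_ne (s := H₀ s') (by rw [hmid.card_eq]; simp) a
      have hdb := hmid.degree_eq b hb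
      have hbinc := h.core b hdb.ge (notMem_of_not_touches hm hb)
      have hbt : b ≠ t := fun e => htn s' (e ▸ (hbinc s').2 hb)
      have hby : b ≠ y := by
        rintro rfl
        have := hylow hba
        lia
      exact ⟨b, (hinc b hbt hba hby s').2 ((hbinc s').2 hb), by
        rw [hdeg b hbt hba hby, familyDegree_congr hbinc, hdb]⟩
    rcases eq_or_ne s' s with rfl | h''
    · rw [hKs, Finset.card_erase_of_mem hys] at hs'
      have := h.trimming.card_le s'
      lia
    · rw [hKo s' h' h''] at hs' ⊢
      obtain ⟨x, hx, hx2⟩ := h.trimming.exists_two_le s' hs'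
      have hxt : x ≠ t := by rintro rfl; lia
      have hxa : x ≠ a := by
        rintro rfl; exact (hao s' hx).elim h' h''
      have hxy : x ≠ y := by
        rintro rfl
        have := hylow hxa
        lia
      exact ⟨x, hx, by rwa [hdeg x hxt hxa hxy]⟩
  · refine h.cover_le.trans (coverNumber_le_of_exchange (x := y) ht
      (familyDegree_pos (s := m) (by simp [hKm])) fun x hx hx' => ?_)
    rcases eq_or_ne x a with rfl | hxa
    · exact familyDegree_pos (s := s) (by simp [hKs, hx, hasH])
    · rwa [hdeg x _ hxa hx]
      rintro rfl; lia
  · intro x hx hxE s'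
    have hxE' : ∀ m' ∈ E, x ∉ H₀ m' := fun m' hm' => hxE m' (Set.mem_insert_of_mem _ hm')
    rw [← h.core x hx hxE' s']
    have hxa : x ≠ a := by
      rintro rfl; exact hxE m (Set.mem_insert _ _) ha
    refine hinc x ?_ hxa ?_ s'
    · rintro rfl
      obtain ⟨s'', hs''⟩ := exists_mem_of_familyDegree_pos (H := H₀) (t := x) (by lia)
      exact htn _ ((h.core x hx hxE' s'').2 hs'')
    · rintro rfl
      have := hylow hxa
      lia
  · intro s' hs'
    refine hKo s' ?_ ?_
    · rintro rfl; exact hs' ⟨s', Set.mem_insert _ _, a, ha, ha⟩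
    · rintro rfl; exact hs' ⟨m, Set.mem_insert _ _, a, ha, has⟩
  · intro x hx
    have hxa : x ≠ a := by rintro rfl; lia
    rcases eq_or_ne x y with rfl | hxy
    · lia
    rcases eq_or_ne x t with rfl | hxt
    · exact htK
    · rw [hdeg x hxt hxa hxy]; exact h.low x hx

-- Here `H₀ s` is `a` with a leaf. Ends of middle edges have degree two, so a broken middle edge
-- could meet `s` only in `a`, and would then touch `m` as well.
omit [Fintype β] [DecidableEq α] in
theorem not_touches_of_isMiddle {m s : α} {a : β} (hE : ∀ m ∈ E, IsMiddle H₀ m)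
    (hm : ¬ Touches H₀ E m) (hmid : IsMiddle H₀ m) (ha : a ∈ H₀ m) (hsm : s ≠ m)
    (has : a ∈ H₀ s) : ¬ Touches H₀ E s := by
  rintro ⟨m', hm', x, hx, hxs⟩
  obtain ⟨c, hca, hsc, hdc⟩ := hmid.leaf a ha s hsm has
  have : x = a ∨ x = c := by simpa [hsc] using hxs
  rcases this with rfl | rfl
  · exact notMem_of_not_touches hm ha m' hm' hx
  · have := (hE m' hm').degree_eq x hx
    lia

/-- The exchange at `m` may remove either point of a neighbouring pair; a point already missing
there is exposed by the invariant. -/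
theorem ExchangeInvariant.subset_exposed {m s : α} {a y : β}
    (h : ExchangeInvariant N H₀ H E) (hE : Exchanges N H₀ H E) (hm : ¬ Touches H₀ E m)
    (hmid : IsMiddle H₀ m) (ht : familyDegree H t = 0) (htm : t ∈ N m) (ha : a ∈ H₀ m)
    (has : a ∈ H₀ s) (hy : y ∈ H₀ s) : y ∈ exposed N H₀ := by
  have key : ∀ a y s, a ∈ H₀ m → s ≠ m → a ∈ H₀ s → y ∈ H₀ s → y ∈ exposed N H₀ := by
    intro a y s ha hsm has hy
    have hs := not_touches_of_isMiddle (fun m hm => (h.block m hm).1) hm hmid ha hsm has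
    rcases h.lost s hs y hy with h' | h'
    · exact ⟨_, _, hE.enter hm hmid ht htm ha hsm has hy h',
        (h.enter_properties hm hmid ht htm ha hsm has hy h' _ rfl).1⟩
    · exact h'
  rcases eq_or_ne s m with rfl | hsm
  · obtain ⟨s1, s2, hne, h1, h2⟩ := two_le_familyDegree.1 (hmid.degree_eq y hy).ge
    rcases eq_or_ne s1 s with rfl | h'
    · exact key y y s2 hy hne.symm h2 h2
    · exact key y y s1 hy h' h1 h1
  · exact key a y s ha hsm has hy

theorem ExchangeInvariant.of_exchanges (h₀ : IsTrimming N H₀) (hE : Exchanges N H₀ H E) :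
    ExchangeInvariant N H₀ H E := by
  induction hE with
  | base => exact ⟨h₀, le_rfl, by simp, by simp, by simp, fun s _ x hx => Or.inl hx, by simp⟩
  | swap hE hs ht hts hx₀ hx hdx ih => exact ih.swap hE hs ht hts hx₀ hx hdx
  | @enter H E m s t a y hE hm hmid ht htm ha hsm has hy₀ hy ih =>
    obtain ⟨-, h1, h2, h3, h4, h5⟩ :=
      ih.enter_properties hm hmid ht htm ha hsm has hy₀ hy _ rfl
    have hT : ∀ s', ¬ Touches H₀ (insert m E) s' → ¬ Touches H₀ E s' :=
      fun s' hs' ⟨m', hm', h'⟩ => hs' ⟨m', Set.mem_insert_of_mem _ hm', h'⟩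
    refine ⟨h1, h2, h3, fun s' hs' => ?_, h5, fun s' hs' => ?_, ?_⟩
    · rw [h4 s' hs']; exact ih.card_eq s' (hT s' hs')
    · rw [h4 s' hs']; exact ih.lost s' (hT s' hs')
    · rintro m' (rfl | hm')
      · exact ⟨hmid, fun s' x hx hxs z hz => ih.subset_exposed hE hm hmid ht htm hx hxs hz⟩
      · exact ih.block m' hm'

end Exchange

end Families

/-! ### Local structure of a maximal trimming -/

section Maximal

open Finset

variable {α β : Type*} [Fintype α] [DecidableEq β] {H : α → Finset β} {t : β}
  [Fintype β] [DecidableEq α] {N H₀ : α → Finset β} {E : Set α}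

-- Degrees only grow, so old witnesses survive and only the enlarged member needs a new one.
omit [Fintype β] in
theorem IsTrimming.update_insert {s : α} {x : β} (h : IsTrimming N H) (hts : t ∈ N s)
    (hcard : #(H s) ≤ 1) (hx : x ∈ insert t (H s))
    (hx2 : #(insert t (H s)) = 2 →
      2 ≤ familyDegree (Function.update H s (insert t (H s))) x) :
    IsTrimming N (Function.update H s (insert t (H s))) := by
  set K := Function.update H s (insert t (H s)) with hK
  have hKs : K s = insert t (H s) := by simp [hK]
  have hKo : ∀ s', s' ≠ s → K s' = H s' := fun s' h' => by simp [hK, h']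
  have hsub : ∀ s', H s' ⊆ K s' := fun s' => by
    rcases eq_or_ne s' s with rfl | h'
    · rw [hKs]; exact Finset.subset_insert _ _
    · rw [hKo s' h']
  refine ⟨fun s' => ?_, fun s' => ?_, fun s' hs' => ?_⟩
  · rcases eq_or_ne s' s with rfl | h'
    · rw [hKs]; exact Finset.insert_subset hts (h.subset _)
    · rw [hKo s' h']; exact h.subset _
  · rcases eq_or_ne s' s with rfl | h'
    · rw [hKs]; exact (Finset.card_insert_le _ _).trans (by lia)
    · rw [hKo s' h']; exact h.card_le _
  · rcases eq_or_ne s' s with rfl | h'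
    · rw [hKs] at hs' ⊢; exact ⟨x, hx, hx2 hs'⟩
    · rw [hKo s' h'] at hs' ⊢
      obtain ⟨y, hy, hy2⟩ := h.exists_two_le s' hs'
      exact ⟨y, hy, hy2.trans (familyDegree_mono fun s'' hs'' => hsub s'' hs'')⟩

omit [Fintype β] in
theorem familyDegree_le_update_insert (s : α) (y : β) :
    familyDegree H y ≤ familyDegree (Function.update H s (insert t (H s))) y := by
  refine familyDegree_mono fun s' hs' => ?_
  rcases eq_or_ne s' s with rfl | h'
  · simp [hs']
  · simpa [h'] using hs'

/-- An exposed point next to `s` exposes the leaf at `s`, or else both points at `s`, which is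
then a middle edge. -/
theorem exposed_neighbour (h₀ : IsTrimming N H₀)
    (hmax : ∀ K, IsTrimming N K → coverNumber K ≤ coverNumber H₀) {s : α}
    (ht : t ∈ exposed N H₀) (hts : t ∈ N s) :
    (∃ x ∈ H₀ s, familyDegree H₀ x = 1 ∧ x ∈ exposed N H₀) ∨
      (IsMiddle H₀ s ∧ ∀ x ∈ H₀ s, x ∈ exposed N H₀) := by
  obtain ⟨H, E, hE, ht0⟩ := ht
  have h := ExchangeInvariant.of_exchanges h₀ hE
  have htn := familyDegree_eq_zero.1 ht0
  by_cases hs : Touches H₀ E s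
  · obtain ⟨m, hm, x, hx, hxs⟩ := hs
    obtain ⟨hmid, hall⟩ := h.block m hm
    rcases eq_or_ne s m with rfl | hsm
    · exact Or.inr ⟨hmid, hall s x hx hxs⟩
    · obtain ⟨c, -, hsc, hdc⟩ := hmid.leaf x hx s hsm hxs
      have hcs : c ∈ H₀ s := by simp [hsc]
      exact Or.inl ⟨c, hcs, hdc, hall s x hx hxs c hcs⟩
  by_cases hleaf : ∃ x ∈ H₀ s, familyDegree H₀ x = 1
  · obtain ⟨x, hx, hdx⟩ := hleaf
    refine Or.inl ⟨x, hx, hdx, ?_⟩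
    rcases h.lost s hs x hx with hxs | hxs
    · have htx : t ≠ x := fun e => htn s (e ▸ hxs)
      refine ⟨_, _, hE.swap hs ht0 hts hx hxs hdx, familyDegree_eq_zero.2 fun s' => ?_⟩
      rcases eq_or_ne s' s with rfl | h'
      · simp [htx.symm]
      · rw [Function.update_of_ne h']
        exact fun hx' => h' (familyDegree_le_one.1 (h.low x hdx.le) _ _ hx' hxs)
    · exact hxs
  push Not at hleaf
  have hdeg2 : ∀ x ∈ H₀ s, 2 ≤ familyDegree H₀ x := fun x hx => by
    have := familyDegree_pos hx
    have := hleaf x hx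
    lia
  have hcore : ∀ x ∈ H₀ s, ∀ s', x ∈ H s' ↔ x ∈ H₀ s' := fun x hx =>
    h.core x (hdeg2 x hx) (notMem_of_not_touches hs hx)
  have hHs : H s = H₀ s := (Finset.eq_of_subset_of_card_le
    (fun x hx => (hcore x hx s).2 hx) (h.card_eq s hs).le).symm
  have hdegH : ∀ x ∈ H₀ s, familyDegree H x = familyDegree H₀ x := fun x hx =>
    familyDegree_congr (hcore x hx)
  -- A trimming that covers `t` and everything `H` covers would beat the maximum.
  have noimp : ∀ K, IsTrimming N K → 0 < familyDegree K t →
      (∀ y, 0 < familyDegree H y → 0 < familyDegree K y) → False := fun K hK h1 h2 => by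
    have h3 := coverNumber_lt ht0 h1 h2
    have h4 := hmax K hK
    have h5 := h.cover_le
    lia
  have hcard2 : #(H₀ s) = 2 := by
    by_contra hc
    have hle := h₀.card_le s
    have hc1 : #(H s) ≤ 1 := by rw [hHs]; lia
    have htK : 0 < familyDegree (Function.update H s (insert t (H s))) t :=
      familyDegree_pos (s := s) (by simp)
    refine noimp _ ?_ htK fun y hy => hy.trans_le (familyDegree_le_update_insert s y)
    rcases (H₀ s).eq_empty_or_nonempty with he | ⟨x, hx⟩
    · refine h.trimming.update_insert hts hc1 (Finset.mem_insert_self _ _) fun h2 => ?_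
      rw [hHs, he] at h2
      simp at h2
    · exact h.trimming.update_insert hts hc1 (Finset.mem_insert_of_mem (hHs ▸ hx)) fun _ =>
        ((hdeg2 x hx).trans (hdegH x hx).ge).trans (familyDegree_le_update_insert s x)
  have hmid : IsMiddle H₀ s := by
    by_contra hmid
    -- If `s` is not a middle edge, replacing one end `a` by `t` isolates no pair: `a` keeps degree
    -- two, or its other member, if a pair, has a second point of degree at least two.
    obtain ⟨a, ha, hdrop⟩ : ∃ a ∈ H₀ s, 3 ≤ familyDegree H₀ a ∨ ∃ s', s' ≠ s ∧ a ∈ H₀ s' ∧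
        familyDegree H₀ a = 2 ∧ ∀ c, c ≠ a → H₀ s' = {a, c} → familyDegree H₀ c ≠ 1 := by
      by_contra! hcon
      refine hmid ⟨hcard2, fun x hx => ?_, fun x hx s' hs' hxs' => ?_⟩
      · have := hdeg2 x hx
        have := (hcon x hx).1
        lia
      · have := hdeg2 x hx
        have := (hcon x hx).1
        exact (hcon x hx).2 s' hs' hxs' (by lia)
    have haH : a ∈ H s := hHs ▸ ha
    have hta : t ≠ a := fun e => htn s (e ▸ haH)
    obtain ⟨b, hb, hba⟩ := Finset.exists_mem_ne (s := H₀ s) (by rw [hcard2]; simp) a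
    have hbH : b ∈ H s := hHs ▸ hb
    have hbt : b ≠ t := fun e => htn s (e ▸ hbH)
    set K := Function.update H s (insert t ((H s).erase a)) with hK
    have hKs : K s = insert t ((H s).erase a) := by simp [hK]
    have hKo : ∀ s', s' ≠ s → K s' = H s' := fun s' h' => by simp [hK, h']
    have hmono : ∀ x, x ≠ a → familyDegree H x ≤ familyDegree K x := by
      intro x hxa
      refine familyDegree_mono fun s' hs' => ?_
      rcases eq_or_ne s' s with rfl | h'
      · simp [hKs, hxa, hs']
      · rwa [hKo s' h']
    have hmonoa : familyDegree H a ≤ familyDegree K a + 1 := by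
      have h1 : ({s' | a ∈ H s'} : Finset α) ⊆ insert s ({s' | a ∈ K s'} : Finset α) := by
        intro s' hs'
        rcases eq_or_ne s' s with rfl | h'
        · simp
        · simpa [h', hKo s' h'] using hs'
      exact (Finset.card_le_card h1).trans (Finset.card_insert_le _ _)
    refine noimp K ⟨fun s' => ?_, fun s' => ?_, fun s' hs' => ?_⟩
      (familyDegree_pos (s := s) (by simp [hKs])) fun y hy => ?_
    · rcases eq_or_ne s' s with rfl | h'
      · rw [hKs]
        exact Finset.insert_subset hts ((Finset.erase_subset _ _).trans (h.trimming.subset _))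
      · rw [hKo s' h']; exact h.trimming.subset _
    · rcases eq_or_ne s' s with rfl | h'
      · rw [hKs]
        refine (Finset.card_insert_le _ _).trans ?_
        rw [Finset.card_erase_of_mem haH, hHs, hcard2]
      · rw [hKo s' h']; exact h.trimming.card_le _
    · rcases eq_or_ne s' s with rfl | h'
      · exact ⟨b, by simp [hKs, hba, hbH],
          ((hdeg2 b hb).trans (hdegH b hb).ge).trans (hmono b hba)⟩
      rw [hKo s' h'] at hs' ⊢
      obtain ⟨x, hx, hx2⟩ := h.trimming.exists_two_le s' hs'
      rcases eq_or_ne x a with rfl | hxa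
      swap
      · exact ⟨x, hx, hx2.trans (hmono x hxa)⟩
      rcases hdrop with h3 | ⟨s1, hs1, has1, hd2, hdrop⟩
      · exact ⟨x, hx, by rw [hdegH x ha] at hmonoa; lia⟩
      have hss : s' = s1 := by
        by_contra hne
        have h3 : #({s, s1, s'} : Finset α) ≤ familyDegree H x := by
          refine Finset.card_le_card fun z => ?_
          simp only [mem_insert, mem_singleton, mem_filter, mem_univ, true_and]
          rintro (rfl | rfl | rfl)
          · exact haH
          · exact (hcore x ha _).2 has1
          · exact hx
        rw [Finset.card_eq_three.2 ⟨s, s1, s', hs1.symm, h'.symm, Ne.symm hne, rfl⟩,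
          hdegH x ha] at h3
        lia
      subst hss
      -- A touched `s'` would have `a` as an end of a broken middle edge or as a leaf; both are
      -- excluded.
      have hT : ¬ Touches H₀ E s' := by
        rintro ⟨m, hm, w, hw, hws⟩
        have hxm : x ∉ H₀ m := notMem_of_not_touches hs ha m hm
        obtain ⟨c, -, hsc, hdc⟩ := (h.block m hm).1.leaf w hw s' (by rintro rfl; exact hxm has1) hws
        have : x = w ∨ x = c := by simpa [hsc] using has1
        rcases this with rfl | rfl
        · exact hxm hw
        · lia
      have hc' : #(H₀ s') = 2 := by rw [← h.card_eq s' hT, hs']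
      obtain ⟨w, hw, hwx⟩ := Finset.exists_mem_ne (s := H₀ s') (by rw [hc']; simp) x
      have hpair : H₀ s' = {x, w} := by
        refine (Finset.eq_of_subset_of_card_le (fun z => ?_) ?_).symm
        · simp only [mem_insert, mem_singleton]; rintro (rfl | rfl) <;> assumption
        · rw [Finset.card_pair hwx.symm, hc']
      have hdw : 2 ≤ familyDegree H₀ w := by
        have := familyDegree_pos hw
        have := hdrop w hwx hpair
        lia
      have hwc := h.core w hdw (notMem_of_not_touches hT hw)
      exact ⟨w, (hwc s').2 hw, by
        rw [← familyDegree_congr hwc] at hdw; exact hdw.trans (hmono w hwx)⟩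
    · rcases eq_or_ne y a with rfl | hya
      · have := hdeg2 y ha
        rw [← hdegH y ha] at this
        lia
      · exact hy.trans_le (hmono y hya)
  exact Or.inr ⟨hmid, fun x hx => h.subset_exposed hE hs hmid ht0 hts hx hx hx⟩

/-! ### Counting unused incidences at exposed points -/

/-- If the cover number and then the total size of `H₀` are maximal, then a member of `H₀` that
consists of a single point of degree one can be extended only by uncovered points. -/
theorem familyDegree_eq_zero_of_lone (h₀ : IsTrimming N H₀)
    (hmax : ∀ K, IsTrimming N K → coverNumber H₀ ≤ coverNumber K →
      ∑ s, #(K s) ≤ ∑ s, #(H₀ s)) {s : α} {x : β}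
    (hs : H₀ s = {x}) (hts : t ∈ N s) (htx : t ≠ x) : familyDegree H₀ t = 0 := by
  by_contra hpos
  obtain ⟨s', hs'⟩ := exists_mem_of_familyDegree_pos (Nat.pos_of_ne_zero hpos)
  have htns : t ∉ H₀ s := by simpa [hs] using htx
  have hne : s' ≠ s := by rintro rfl; exact htns hs'
  have hK : IsTrimming N (Function.update H₀ s (insert t (H₀ s))) :=
    h₀.update_insert hts (by simp [hs]) (Finset.mem_insert_self _ _) fun _ =>
      two_le_familyDegree.2 ⟨s, s', hne.symm, by simp, by simpa [hne] using hs'⟩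
  have h1 : coverNumber H₀ ≤ coverNumber (Function.update H₀ s (insert t (H₀ s))) :=
    Finset.card_le_card fun y hy => by
      simp only [mem_filter, mem_univ, true_and] at hy ⊢
      exact hy.trans_le (familyDegree_le_update_insert s y)
  refine (hmax _ hK h1).not_gt (Finset.sum_lt_sum (fun s' _ => ?_) ⟨s, mem_univ _, ?_⟩)
  · rcases eq_or_ne s' s with rfl | h'
    · simpa using Finset.card_le_card (Finset.subset_insert _ _)
    · simp [h']
  · simp [Finset.card_insert_of_notMem htns]

-- Any other member through an end of a middle edge contains a leaf, and a middle edge has none.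
omit [Fintype β] [DecidableEq α] in
theorem IsMiddle.eq_of_mem {m m' : α} {x : β} (h : IsMiddle H m) (h' : IsMiddle H m')
    (hx : x ∈ H m) (hx' : x ∈ H m') : m = m' := by
  by_contra hne
  obtain ⟨c, -, hc, hdc⟩ := h.leaf x hx m' (Ne.symm hne) hx'
  have := h'.degree_eq c (by simp [hc])
  lia

theorem familyDegree_pos_of_maximal (hN4 : ∀ s, #(N s) ≤ 4)
    (hN3 : ∀ t, familyDegree N t = 3) (h₀ : IsTrimming N H₀)
    (hmax : ∀ K, IsTrimming N K → coverNumber K ≤ coverNumber H₀)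
    (hmax' : ∀ K, IsTrimming N K → coverNumber H₀ ≤ coverNumber K →
      ∑ s, #(K s) ≤ ∑ s, #(H₀ s)) (z : β) : 0 < familyDegree H₀ z := by
  classical
  by_contra hz
  have hz0 : familyDegree H₀ z = 0 := by lia
  set R : Finset β := {t | t ∈ exposed N H₀} with hR
  have hmemR : ∀ t, t ∈ R ↔ t ∈ exposed N H₀ := by simp [hR]
  have hzR : z ∈ R := (hmemR z).2 ⟨H₀, ∅, .base, hz0⟩
  set lone : α → Prop := fun s => ∃ x, H₀ s = {x} ∧ familyDegree H₀ x = 1 with hlone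
  -- `A` marks the points that pay for `s`, `B` the unused incidences to be paid for.
  set A : α → β → Prop := fun s t =>
    ¬ lone s ∧ t ∈ H₀ s ∧ (familyDegree H₀ t = 1 ∨ IsMiddle H₀ s) with hA
  set B : α → β → Prop := fun s t => ¬ lone s ∧ t ∈ N s ∧ t ∉ H₀ s with hB
  have hk : ∀ t, #{s | A s t} ≤ 1 := by
    intro t
    rw [Finset.card_le_one]
    simp only [mem_filter, mem_univ, true_and]
    rintro s ⟨-, hs, h1⟩ s' ⟨-, hs', h2⟩
    by_cases hd : familyDegree H₀ t = 1
    · exact familyDegree_le_one.1 hd.le _ _ hs hs'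
    · exact (h1.resolve_left hd).eq_of_mem (h2.resolve_left hd) hs hs'
  have hA0 : ∀ t, familyDegree H₀ t = 0 → #{s | A s t} = 0 := by
    intro t ht
    rw [Finset.card_eq_zero, Finset.filter_eq_empty_iff]
    exact fun s _ hs => familyDegree_eq_zero.1 ht s hs.2.1
  have hout : ∀ t, (∀ s, lone s → t ∈ N s → t ∈ H₀ s) →
      #{s | B s t} = 3 - familyDegree H₀ t := by
    intro t ht
    have : ({s | B s t} : Finset α) = ({s | t ∈ N s} : Finset α) \ ({s | t ∈ H₀ s} : Finset α) := by
      ext s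
      simp only [hB, mem_filter, mem_univ, true_and, mem_sdiff]
      exact ⟨fun h => h.2, fun h => ⟨fun hl => h.2 (ht s hl h.1), h⟩⟩
    rw [this, Finset.card_sdiff_of_subset]
    · have := hN3 t
      unfold familyDegree at this ⊢
      rw [this]
    · intro s
      simp only [mem_filter, mem_univ, true_and]
      exact fun h => h₀.subset s h
  -- This is where maximal total size enters: omitting lone members costs a covered point none of
  -- its unused incidences.
  have hcov : ∀ t, familyDegree H₀ t ≠ 0 → ∀ s, lone s → t ∈ N s → t ∈ H₀ s := by
    rintro t ht s ⟨x, hx, -⟩ hts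
    by_contra hn
    exact ht (familyDegree_eq_zero_of_lone h₀ hmax' hx hts (by simpa [hx] using hn))
  have hin : ∀ s, #{t ∈ R | B s t} ≤ ∑ t ∈ R with A s t, (3 - familyDegree H₀ t) := by
    intro s
    rcases ({t ∈ R | B s t} : Finset β).eq_empty_or_nonempty with he | ⟨t, ht⟩
    · simp [he]
    simp only [mem_filter] at ht
    obtain ⟨htR, hl, hts, -⟩ := ht
    have hle : #(H₀ s) = 2 → #{t ∈ R | B s t} ≤ 2 := fun h2 => by
      have h3 : ({t ∈ R | B s t} : Finset β) ⊆ N s \ H₀ s := by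
        intro y
        simp only [hB, mem_filter, mem_sdiff]
        exact fun h => h.2.2
      have h4 := Finset.card_le_card h3
      rw [Finset.card_sdiff_of_subset (h₀.subset s), h2] at h4
      have := hN4 s
      lia
    rcases exposed_neighbour h₀ hmax ((hmemR t).1 htR) hts with ⟨x, hx, hdx, hxR⟩ | ⟨hmid, hall⟩
    · have h2 : #(H₀ s) = 2 := by
        have h3 := h₀.card_le s
        have h4 := Finset.card_pos.2 ⟨x, hx⟩
        by_contra h5
        obtain ⟨y, hy⟩ := Finset.card_eq_one.1 (by lia : #(H₀ s) = 1)
        rw [hy, mem_singleton] at hx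
        exact hl ⟨y, hy, hx ▸ hdx⟩
      calc _ ≤ 2 := hle h2
        _ = 3 - familyDegree H₀ x := by rw [hdx]
        _ ≤ _ := Finset.single_le_sum (f := fun t => 3 - familyDegree H₀ t)
          (fun _ _ => Nat.zero_le _) (by
            simp only [mem_filter]
            exact ⟨(hmemR x).2 hxR, hl, hx, Or.inl hdx⟩)
    · calc _ ≤ 2 := hle hmid.card_eq
        _ = ∑ t ∈ H₀ s, (3 - familyDegree H₀ t) := by
          rw [Finset.sum_congr rfl fun t ht => by rw [hmid.degree_eq t ht]]
          simp [hmid.card_eq]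
        _ ≤ _ := Finset.sum_le_sum_of_subset fun y hy => by
            simp only [mem_filter]
            exact ⟨(hmemR y).2 (hall y hy), hl, hy, Or.inr hmid⟩
  have hsum : ∑ t ∈ R, #{s | B s t} ≤ ∑ t ∈ R, #{s | A s t} * (3 - familyDegree H₀ t) := by
    calc ∑ t ∈ R, #{s | B s t} = ∑ s, #{t ∈ R | B s t} :=
          (Finset.sum_card_bipartiteAbove_eq_sum_card_bipartiteBelow (s := R) (t := univ)
            (fun t s => B s t))
      _ ≤ ∑ s, ∑ t ∈ R with A s t, (3 - familyDegree H₀ t) := Finset.sum_le_sum fun s _ => hin s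
      _ = ∑ t ∈ R, #{s | A s t} * (3 - familyDegree H₀ t) := by
        simp_rw [Finset.sum_filter]
        rw [Finset.sum_comm]
        refine Finset.sum_congr rfl fun t _ => ?_
        rw [← Finset.sum_filter, Finset.sum_const, smul_eq_mul]
  refine hsum.not_gt (Finset.sum_lt_sum (fun t _ => ?_) ?_)
  · rcases eq_or_ne (familyDegree H₀ t) 0 with h | h
    · rw [hA0 t h]; simp
    · rw [hout t (hcov t h)]
      exact (Nat.mul_le_mul_right _ (hk t)).trans (by simp)
  -- Strictness: the leaf of a lone member next to `z` has two unused incidences and pays nothing;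
  -- without such a member, `z` itself has three.
  · by_cases hzl : ∃ s, lone s ∧ z ∈ N s
    · obtain ⟨s, hl, hzs⟩ := hzl
      obtain ⟨x, hx, hdx⟩ := hl
      have hxR : x ∈ R := by
        rcases exposed_neighbour h₀ hmax ((hmemR z).1 hzR) hzs with ⟨y, hy, -, hyR⟩ | ⟨-, hall⟩
        · rw [hx, mem_singleton] at hy
          exact (hmemR x).2 (hy ▸ hyR)
        · exact (hmemR x).2 (hall x (by simp [hx]))
      refine ⟨x, hxR, ?_⟩
      have : #{s | A s x} = 0 := by
        rw [Finset.card_eq_zero, Finset.filter_eq_empty_iff]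
        rintro s' - ⟨hl', hs', -⟩
        obtain rfl := familyDegree_le_one.1 hdx.le s s' (by simp [hx]) hs'
        exact hl' ⟨x, hx, hdx⟩
      have h2 := hout x (hcov x (by lia))
      rw [this, h2]
      lia
    · push Not at hzl
      refine ⟨z, hzR, ?_⟩
      rw [hout z fun s hl hzs => absurd hzs (hzl s hl), hA0 z hz0]
      lia

/-- If all members of `N` have at most four points and each point is in exactly three of them,
then `N` has a trimming that covers all points. -/
theorem exists_isTrimming_cover (hN4 : ∀ s, #(N s) ≤ 4) (hN3 : ∀ t, familyDegree N t = 3) :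
    ∃ H, IsTrimming N H ∧ ∀ t, 0 < familyDegree H t := by
  have : Nonempty {H // IsTrimming N H} :=
    ⟨⟨fun _ => ∅, ⟨by simp, by simp, by simp⟩⟩⟩
  obtain ⟨⟨H, hH⟩, hmax⟩ := Finite.exists_max
    (fun H : {H // IsTrimming N H} => toLex (coverNumber H.1, ∑ s, #(H.1 s)))
  refine ⟨H, hH, familyDegree_pos_of_maximal hN4 hN3 hH (fun K hK => ?_) fun K hK h => ?_⟩
  · rcases Prod.Lex.toLex_le_toLex.1 (hmax ⟨K, hK⟩) with h | h
    · exact h.le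
    · exact h.1.le
  · rcases Prod.Lex.toLex_le_toLex.1 (hmax ⟨K, hK⟩) with h' | h'
    · exact absurd h' h.not_gt
    · exact h'.2

/-! ### From covering trimmings to representatives and pairs -/

omit [Fintype β] [DecidableEq α] in
/-- A covering trimming splits into a system of distinct representatives of some points and
disjoint pairs for the others. -/
theorem IsTrimming.exists_representatives (h : IsTrimming N H)
    (hcov : ∀ t, 0 < familyDegree H t) :
    ∃ (X : Set β) (f p q : β → α), Set.InjOn f X ∧ (∀ t ∈ X, t ∈ N (f t)) ∧
      (∀ t ∉ X, p t ≠ q t ∧ t ∈ N (p t) ∧ t ∈ N (q t)) ∧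
      ∀ t ∉ X, ∀ t' ∉ X, t ≠ t' → Disjoint ({p t, q t} : Set α) {p t', q t'} := by
  have hm : ∀ s, (H s).Nonempty → ∃ x ∈ H s, ∀ y ∈ H s, familyDegree H y ≤ 1 → y = x := by
    rintro s ⟨z, hz⟩
    by_cases hy : ∃ y ∈ H s, familyDegree H y ≤ 1
    · obtain ⟨x, hx, hdx⟩ := hy
      refine ⟨x, hx, fun y hy hdy => ?_⟩
      by_contra hne
      have := h.two_le_of_ne hx hy hne hdx
      lia
    · push Not at hy
      exact ⟨z, hz, fun y hy' hdy => absurd hdy (hy y hy').not_ge⟩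
  choose m hmem hleaf using hm
  have hf : ∀ t, ∃ s, t ∈ H s ∧ ((∃ s, ∃ hs, m s hs = t) → ∃ hs, m s hs = t) := by
    intro t
    by_cases ht : ∃ s, ∃ hs, m s hs = t
    · obtain ⟨s, hs, rfl⟩ := ht
      exact ⟨s, hmem s hs, fun _ => ⟨hs, rfl⟩⟩
    · obtain ⟨s, hs⟩ := exists_mem_of_familyDegree_pos (hcov t)
      exact ⟨s, hs, fun h' => absurd h' ht⟩
  have hpq : ∀ t, ∃ p q, t ∈ H p ∧ t ∈ H q ∧ ((¬ ∃ s, ∃ hs, m s hs = t) → p ≠ q) := by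
    intro t
    rcases lt_or_ge 1 (familyDegree H t) with hd | hd
    · obtain ⟨p, q, hne, hp, hq⟩ := two_le_familyDegree.1 hd
      exact ⟨p, q, hp, hq, fun _ => hne⟩
    · obtain ⟨s, hs⟩ := exists_mem_of_familyDegree_pos (hcov t)
      -- The choice `p = q` is harmless: a point of degree one is represented by its own member.
      exact ⟨s, s, hs, hs, fun h' => absurd ⟨s, ⟨t, hs⟩, (hleaf s ⟨t, hs⟩ t hs hd).symm⟩ h'⟩
  choose f hfH hfm using hf
  choose p q hp hq hne using hpq
  refine ⟨{t | ∃ s, ∃ hs, m s hs = t}, f, p, q, fun t ht t' ht' he => ?_,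
    fun t _ => h.subset _ (hfH t),
    fun t ht => ⟨hne t ht, h.subset _ (hp t), h.subset _ (hq t)⟩, fun t ht t' ht' htt' => ?_⟩
  · obtain ⟨h1, h2⟩ := hfm t ht
    obtain ⟨h3, h4⟩ := hfm t' ht'
    rw [← h2, ← h4]
    congr 1
  · have key : ∀ s, t ∈ H s → t' ∈ H s → False := by
      intro s hs hs'
      -- Two unrepresented points and the representative would be three points in one member.
      have hc : #({t, t', m s ⟨t, hs⟩} : Finset β) ≤ #(H s) := by
        refine Finset.card_le_card fun z => ?_
        simp only [mem_insert, mem_singleton]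
        rintro (rfl | rfl | rfl)
        · exact hs
        · exact hs'
        · exact hmem _ _
      rw [Finset.card_eq_three.2 ⟨t, t', m s ⟨t, hs⟩, htt', fun e => ht ⟨s, _, e.symm⟩,
        fun e => ht' ⟨s, _, e.symm⟩, rfl⟩] at hc
      have := h.card_le s
      lia
    rw [Set.disjoint_left]
    rintro s (rfl | rfl) (h' | h')
    · exact key _ (hp t) (h' ▸ hp t')
    · exact key _ (hp t) (h' ▸ hq t')
    · exact key _ (hq t) (h' ▸ hp t')
    · exact key _ (hq t) (h' ▸ hq t')

end Maximal

/-! ### Links as subgraphs and the theorem -/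

section Links

variable {V : Type*} {G : SimpleGraph V}

/-- The path `u v w` as a subgraph. -/
def linkSubgraph {u v w : V} (huv : G.Adj u v) (hvw : G.Adj v w) : G.Subgraph :=
  G.subgraphOfAdj huv ⊔ G.subgraphOfAdj hvw

theorem linkSubgraph_verts {u v w : V} (huv : G.Adj u v) (hvw : G.Adj v w) :
    (linkSubgraph huv hvw).verts = {u, v, w} := by
  ext x
  simp [linkSubgraph]
  tauto

theorem linkSubgraph_edgeSet {u v w : V} (huv : G.Adj u v) (hvw : G.Adj v w) :
    (linkSubgraph huv hvw).edgeSet = {s(u, v), s(v, w)} := by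
  simp [linkSubgraph, SimpleGraph.Subgraph.edgeSet_sup, SimpleGraph.edgeSet_subgraphOfAdj,
    Set.pair_comm]

end Links

theorem mainTheorem4 {V : Type*} [Fintype V] (G : SimpleGraph V) [DecidableRel G.Adj]
    (S T : Set V) (hG : G.IsBipartiteWith S T)
    (hS : ∀ v ∈ S, G.degree v ≤ 4) (hT : ∀ v ∈ T, G.degree v ≤ 3) :
    ∃ (M : G.Subgraph) (F : Set G.Subgraph),
      M.IsMatching ∧
      (∀ P ∈ F, P.IsLink S) ∧
      F.PairwiseDisjoint SimpleGraph.Subgraph.verts ∧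
      ∀ v ∈ T, G.degree v = 3 →
        ∃ e ∈ M.edgeSet ∪ ⋃ P ∈ F, P.edgeSet, v ∈ e := by
  classical
  set N : S → Finset {v // v ∈ T ∧ G.degree v = 3} := fun s => {t | G.Adj s t} with hN
  have hmemN : ∀ s t, t ∈ N s ↔ G.Adj s t := by simp [hN]
  have hST : ∀ (s : S) (t : {v // v ∈ T ∧ G.degree v = 3}), (s : V) ≠ t := fun s t e =>
    Set.disjoint_left.1 hG.disjoint s.2 (e ▸ t.2.1)
  have hN4 : ∀ s, (N s).card ≤ 4 := by
    intro s
    refine le_trans ?_ (hS s s.2)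
    rw [← SimpleGraph.card_neighborFinset_eq_degree]
    refine Finset.card_le_card_of_injOn Subtype.val (fun t ht => ?_) Subtype.val_injective.injOn
    simpa using (hmemN s t).1 ht
  have hN3 : ∀ t, familyDegree N t = 3 := by
    intro t
    refine Eq.trans ?_ ((G.card_neighborFinset_eq_degree t).trans t.2.2)
    refine Finset.card_bij (fun s _ => (s : V)) (fun s hs => ?_)
      (fun _ _ _ _ h => Subtype.val_injective h) (fun v hv => ?_)
    · simp only [Finset.mem_filter, Finset.mem_univ, true_and, hmemN] at hs
      simpa using hs.symm
    · rw [SimpleGraph.mem_neighborFinset] at hv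
      refine ⟨⟨v, hG.mem_of_mem_adj' t.2.1 hv.symm⟩, ?_, rfl⟩
      simpa [hmemN] using hv.symm
  obtain ⟨H, hH, hcov⟩ := exists_isTrimming_cover hN4 hN3
  obtain ⟨X, f, p, q, hinj, hf, hpq, hdisj⟩ := hH.exists_representatives hcov
  have hfA : ∀ t ∈ X, G.Adj (f t) t := fun t ht => (hmemN _ _).1 (hf t ht)
  have hpA : ∀ t ∉ X, G.Adj (p t) t := fun t ht => (hmemN _ _).1 (hpq t ht).2.1
  have hqA : ∀ t ∉ X, G.Adj t (q t) := fun t ht => ((hmemN _ _).1 (hpq t ht).2.2).symm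
  refine ⟨⨆ t : X, G.subgraphOfAdj (hfA t t.2),
    Set.range fun t : (Xᶜ : Set _) => linkSubgraph (hpA t t.2) (hqA t t.2), ?_, ?_, ?_, ?_⟩
  · refine SimpleGraph.Subgraph.IsMatching.iSup
      (fun t => SimpleGraph.Subgraph.IsMatching.subgraphOfAdj _) fun t t' htt' => ?_
    simp only [SimpleGraph.support_subgraphOfAdj]
    rw [Set.disjoint_left]
    have h1 : (f t : V) ≠ f t' := fun e =>
      htt' (Subtype.ext (hinj t.2 t'.2 (Subtype.ext e)))
    have h2 : ((t : {v // v ∈ T ∧ G.degree v = 3}) : V) ≠ (t' : {v // v ∈ T ∧ G.degree v = 3}) :=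
      fun e => htt' (Subtype.ext (Subtype.ext e))
    rintro x (rfl | rfl) (h | h)
    · exact h1 h
    · exact hST _ _ h
    · exact hST _ _ h.symm
    · exact h2 h
  · rintro _ ⟨t, rfl⟩
    exact ⟨p t, t, q t, (p t).2, (q t).2, fun e => (hpq t t.2).1 (Subtype.ext e),
      linkSubgraph_verts _ _, linkSubgraph_edgeSet _ _⟩
  · rintro _ ⟨t, rfl⟩ _ ⟨t', rfl⟩ hne
    have htt' : (t : {v // v ∈ T ∧ G.degree v = 3}) ≠ t' := by
      intro e
      exact hne (by rw [Subtype.ext e])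
    have hd := hdisj t t.2 t' t'.2 htt'
    rw [Set.disjoint_left] at hd
    simp only [Function.onFun, linkSubgraph_verts]
    rw [Set.disjoint_left]
    have hpq' : ∀ s ∈ ({p t, q t} : Set S), ∀ s' ∈ ({p t', q t'} : Set S), (s : V) ≠ s' :=
      fun s hs s' hs' e => hd hs (Subtype.ext e ▸ hs')
    rintro x (rfl | rfl | rfl) (h | h | h)
    · exact hpq' _ (by simp) _ (by simp) h
    · exact hST _ _ h
    · exact hpq' _ (by simp) _ (by simp) h
    · exact hST _ _ h.symm
    · exact htt' (Subtype.ext h)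
    · exact hST _ _ h.symm
    · exact hpq' _ (by simp) _ (by simp) h
    · exact hST _ _ h
    · exact hpq' _ (by simp) _ (by simp) h
  · intro v hv hd
    by_cases hX : (⟨v, hv, hd⟩ : {v // v ∈ T ∧ G.degree v = 3}) ∈ X
    · refine ⟨s(f ⟨v, hv, hd⟩, v), Or.inl ?_, by simp⟩
      rw [SimpleGraph.Subgraph.edgeSet_iSup, Set.mem_iUnion]
      exact ⟨⟨_, hX⟩, by simp⟩
    · refine ⟨s(p ⟨v, hv, hd⟩, v), Or.inr ?_, by simp⟩
      simp only [Set.mem_iUnion]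
      exact ⟨_, ⟨⟨_, hX⟩, rfl⟩, by rw [linkSubgraph_edgeSet]; simp⟩
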